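/- Let $k$ be a commutative unitary ring of characteristic zero, $\lambda\in k$, and $(X,\le)$ a well-ordered set. Let $\mathfrak S(X)$ be the set of nonunitary bracketed words on $X$, i.e. the free semigroup on $X$ with a unary operation $u\mapsto\lfloor u\rfloor$: its elements are the nonempty finite products $w=w_1\cdots w_n$ of primes, a prime being a letter $x\in X$ or a bracket $\lfloor u\rfloor$ with $u\in\mathfrak S(X)$; $|w|:=n$ is the breadth. Let $k\mathfrak S(X)$ be the (nonunitary) $k$-algebra with basis $\mathfrak S(X)$ and with the operator $\lfloor\ \rfloor$ extended linearly. Let $\mathfrak S^\star(X)$ be the set of bracketed words on $X\sqcup\{\star\}$ in which $\star$ occurs exactly once, and for $q\in\mathfrak S^\star(X)$ let $q|_s$ be the result of replacing $\star$ by $s$ (extended linearly to $s\in k\mathfrak S(X)$). *The order.* Put $x<P<\mu$ for all $x\in X$ and order the words in $X\sqcup\{P,\mu\}$ degree-lexicographically. The path of a letter occurrence in $w$ is defined by: the path of $x$ in the word $x$ is $x$; its path in $\lfloor u\rfloor$ is $P$ followed by its path in $u$; its path in $w_1\cdots w_n$ with $n\ge2$ is $\mu$ followed by its path in the prime $w_j$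 in which it lies. Let $\deg(w)$ be the number of letter occurrences in $w$ and $\mathrm{path}_l(w)$ the tuple of their paths, from left to right. Write $u<_{PL_l}v$ if $(\deg u,\mathrm{path}_l(u))<(\deg v,\mathrm{path}_l(v))$ lexicographically. *Gröbner–Shirshov bases.* The leading monomial $\overline f$ of $f$ is the monomial of $f$ that is greater than all other monomials of $f$; $f$ is monic if $\overline f$ exists and has coefficient $1$. For $S\subseteq k\mathfrak S(X)$ and $w\in\mathfrak S(X)$, an element is trivial modulo $(S,w)$ if it is a $k$-linear combination of elements $q|_s$ with $q\in\mathfrak S^\star(X)$, $s\in S$, $\overline{q|_s}<w$. The set $S$ is a Gröbner–Shirshov basis if it is monic and, for all $f,g\in S$, every intersection composition $fu-vg$ (where $w=\overline f u=v\overline g$, $\max(|\overline f|,|\overline g|)<|w|<|\overline f|+|\overline g|$) and every including composition $f-q|_g$ (where $w=\overline f=q|_{\overline g}$) is trivial modulo $(S,w)$. **Theorem.** Let $$S=\{\lfloor\lfloor x\rfloor y\rfloor+\lfloor x\lfloor y\rfloor\rfloor+\lambda xy-\lfloor x\rfloor\lfloor y\rfloor \mid x,y\in\mathfrak S(X)\},$$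 and let $\mathrm{Id}(S)$ be the operated ideal generated by $S$, i.e. the smallest two-sided ideal and $k$-submodule of $k\mathfrak S(X)$ that contains $S$ and is closed under $\lfloor\ \rfloor$. 1. The relation $<_{PL_l}$ is well-founded. With respect to it, the element of $S$ given by $x,y$ has leading monomial $\lfloor\lfloor x\rfloor y\rfloor$, and $\overline{q|_s}=q|_{\overline s}$ for all $s\in S$ and $q\in\mathfrak S^\star(X)$. The set $S$ is a Gröbner–Shirshov basis in $k\mathfrak S(X)$ with respect to $<_{PL_l}$. 2. The quotient $k\mathfrak S(X)/\mathrm{Id}(S)$ with the induced operator is the free nonunitary modified Rota–Baxter algebra of weight $\lambda$ on $X$: its operator $P$ satisfies $P(a)P(b)=P(P(a)b+aP(b))+\lambda ab$, and every map from $X$ to a nonunitary associative $k$-algebra with a linear operator that satisfies this identity extends uniquely to a homomorphism of $k$-algebras on the quotient that commutes with the operators. The images of the words in $$\mathrm{Irr}(S)=\mathfrak S(X)\setminus\{q|_{\lfloor\lfloor x\rfloor y\rfloor}\mid x,y\in\mathfrak S(X),\ q\in\mathfrak S^\star(X)\}$$ form a $k$-basis of it. -/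

import Mathlib

namespace MRB

/-! ### Bracketed words without unit: the free operated semigroup on `X` -/

/-- The set `𝔖(X)` of nonunitary bracketed words on `X`.  A bracketed word is a nonempty finite
sequence of primes, a prime being a letter `x ∈ X` or a bracket `⌊u⌋` of a bracketed word `u`.
The four constructors list the words by their first prime and by whether anything follows it:
`x`, `⌊u⌋`, `x v` and `⌊u⌋ v`.  Every word has exactly one such form. -/
inductive BWord (X : Type*) where
  | var (x : X) : BWord X
  | br (u : BWord X) : BWord X
  | varMul (x : X) (v : BWord X) : BWord X
  | brMul (u : BWord X) (v : BWord X) : BWord X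

namespace BWord

variable {X : Type*}

/-- Concatenation of bracketed words. -/
def mul : BWord X → BWord X → BWord X
  | var x, w => varMul x w
  | br u, w => brMul u w
  | varMul x v, w => varMul x (mul v w)
  | brMul u v, w => brMul u (mul v w)

instance : Mul (BWord X) := ⟨mul⟩

theorem var_mul (x : X) (w : BWord X) : var x * w = varMul x w := rfl

theorem br_mul (u w : BWord X) : br u * w = brMul u w := rfl

theorem varMul_mul (x : X) (v w : BWord X) : varMul x v * w = varMul x (v * w) := rfl

theorem brMul_mul (u v w : BWord X) : brMul u v * w = brMul u (v * w) := rfl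

instance : Semigroup (BWord X) where
  mul_assoc a b c := by
    induction a with
    | var x => rfl
    | br u _ => rfl
    | varMul x v ih => simp only [varMul_mul, ih]
    | brMul u v _ ih => simp only [brMul_mul, ih]

/-- The breadth `|w|`: the number of primes in the prime factorization of `w`. -/
def breadth : BWord X → ℕ
  | var _ => 1
  | br _ => 1
  | varMul _ v => 1 + breadth v
  | brMul _ v => 1 + breadth v

/-! ### Words with one star -/

/-- The number of occurrences of the symbol `⋆` in a bracketed word on `X ⊔ {⋆}`;
here `X ⊔ {⋆}` is `Option X`, with `none` as `⋆`. -/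
def starCount : BWord (Option X) → ℕ
  | var none => 1
  | var (some _) => 0
  | br u => starCount u
  | varMul none v => 1 + starCount v
  | varMul (some _) v => starCount v
  | brMul u v => starCount u + starCount v

/-- Replace every occurrence of `⋆` in `q` by `u`. -/
def fill (u : BWord X) : BWord (Option X) → BWord X
  | var none => u
  | var (some x) => var x
  | br q => br (fill u q)
  | varMul none q => u * fill u q
  | varMul (some x) q => var x * fill u q
  | brMul p q => br (fill u p) * fill u q

end BWord

/-- The set `𝔖^⋆(X)` of `⋆`-bracketed words: bracketed words on `X ⊔ {⋆}` with exactly one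
occurrence of `⋆`. -/
def StarWord (X : Type*) := {q : BWord (Option X) // q.starCount = 1}

/-- `q|_u` for `q ∈ 𝔖^⋆(X)` and `u ∈ 𝔖(X)`. -/
def StarWord.app {X : Type*} (q : StarWord X) (u : BWord X) : BWord X := BWord.fill u q.1

/-! ### The path order -/

/-- The alphabet `X ⊔ {P, μ}`, ordered by `x < P < μ` for all `x ∈ X`. -/
abbrev PathAlphabet (X : Type*) := WithTop (WithTop X)

/-- The symbol `μ` of multiplication, the largest symbol. -/
def symMul {X : Type*} : PathAlphabet X := ⊤

/-- The symbol `P` of the operator, the second largest symbol. -/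
def symOp {X : Type*} : PathAlphabet X := ((⊤ : WithTop X) : WithTop (WithTop X))

/-- A letter `x ∈ X` as a symbol. -/
def symVar {X : Type*} (x : X) : PathAlphabet X := ((x : WithTop X) : WithTop (WithTop X))

namespace BWord

variable {X : Type*}

/-- The number of occurrences of letters of `X` in a word. -/
def degX : BWord X → ℕ
  | var _ => 1
  | br u => degX u
  | varMul _ v => 1 + degX v
  | brMul u v => degX u + degX v

/-- `path_l(w)`: the paths `path_w(x₁), …, path_w(x_k)` of the letters of `w`, from left to right.
One has `path_x(x) = x`; the path of a letter in `⌊u⌋` is `P` followed by its path in `u`; the path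
of a letter in `w = w₁ ⋯ w_n` with `n ≥ 2` primes is `μ` followed by its path in its prime `w_j`.
In the last two clauses, if the remaining word `v` has breadth at least 2, then the paths in `v`
carry the symbol `μ` already. -/
def pathL : BWord X → List (List (PathAlphabet X))
  | var x => [[symVar x]]
  | br u => (pathL u).map (fun p => symOp :: p)
  | varMul x v =>
      [symMul, symVar x] ::
        (if breadth v = 1 then (pathL v).map (fun p => symMul :: p) else pathL v)
  | brMul u v =>
      (pathL u).map (fun p => symMul :: symOp :: p) ++
        (if breadth v = 1 then (pathL v).map (fun p => symMul :: p) else pathL v)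

/-- The strict relation `u <_{PL_l} v`: `(deg u, path_l u) < (deg v, path_l v)` lexicographically,
where the entries of `path_l` are compared by the degree lexicographical order on words in
`X ⊔ {P, μ}`. -/
def pathLT [LinearOrder X] (u v : BWord X) : Prop :=
  degX u < degX v ∨
    (degX u = degX v ∧ List.Lex (List.Shortlex (· < ·)) (pathL u) (pathL v))

end BWord

/-! ### Gröbner–Shirshov bases in `k𝔖(X)` -/

noncomputable section

open MonoidAlgebra

variable {k : Type*} [CommRing k] {X : Type*}

/-- `k𝔖(X)`, the free module on the bracketed words with the multiplication extended linearly. -/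
abbrev WordAlg (k : Type*) [CommRing k] (X : Type*) := MonoidAlgebra k (BWord X)

/-- A bracketed word as an element of `k𝔖(X)`. -/
def mon (k : Type*) [CommRing k] {X : Type*} (u : BWord X) : WordAlg k X := single u 1

/-- The operator `⌊ ⌋` on `k𝔖(X)`, extended linearly from words. -/
def bracketOp (k : Type*) [CommRing k] (X : Type*) : WordAlg k X →ₗ[k] WordAlg k X :=
  mapDomainLinearMap k k BWord.br

/-- `q|_s` for `s ∈ k𝔖(X)`, extended linearly from words. -/
def StarWord.appLin (q : StarWord X) (s : WordAlg k X) : WordAlg k X := mapDomain q.app s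

/-- `u` is the leading monomial of `f`: it occurs in `f` and every other monomial that occurs in
`f` is smaller. -/
def IsLeadingMonomial (lt : BWord X → BWord X → Prop) (f : WordAlg k X) (u : BWord X) : Prop :=
  u ∈ f.coeff.support ∧ ∀ v ∈ f.coeff.support, v ≠ u → lt v u

/-- `f` has a leading monomial, and its coefficient is `1`. -/
def IsMonic (lt : BWord X → BWord X → Prop) (f : WordAlg k X) : Prop :=
  ∃ u, IsLeadingMonomial lt f u ∧ f.coeff u = 1

/-- `f` is trivial modulo `(S, w)`: it is a linear combination of elements `q|_s` with `s ∈ S`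
whose leading monomials are smaller than `w`. -/
def IsTrivialMod (lt : BWord X → BWord X → Prop) (S : Set (WordAlg k X)) (w : BWord X)
    (f : WordAlg k X) : Prop :=
  f ∈ Submodule.span k
    {g | ∃ q : StarWord X, ∃ s ∈ S, g = q.appLin s ∧ ∃ v, IsLeadingMonomial lt g v ∧ lt v w}

/-- `S` is a Gröbner–Shirshov basis in `k𝔖(X)`: it is monic, and all intersection compositions
`f u - v g` and all including compositions `f - q|_g` of its elements are trivial. -/
def IsGroebnerShirshov (lt : BWord X → BWord X → Prop) (S : Set (WordAlg k X)) : Prop :=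
  (∀ s ∈ S, IsMonic lt s) ∧
  ∀ f ∈ S, ∀ g ∈ S, ∀ a b : BWord X, IsLeadingMonomial lt f a → IsLeadingMonomial lt g b →
    (∀ u v w : BWord X, w = a * u → w = v * b →
      max a.breadth b.breadth < w.breadth → w.breadth < a.breadth + b.breadth →
      IsTrivialMod lt S w (f * mon k u - mon k v * g)) ∧
    (∀ (q : StarWord X) (w : BWord X), w = a → w = q.app b →
      IsTrivialMod lt S w (f - q.appLin g))

/-! ### Operated ideals and quotients -/

/-- An operated ideal of a nonunitary `k`-algebra `A` with a linear operator `P`: a submodule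
closed under multiplication from both sides and under `P`. -/
structure OperatedIdeal {A : Type*} [NonUnitalRing A] [Module k A] (P : A →ₗ[k] A) extends
    Submodule k A where
  mul_left_mem : ∀ (a : A) {x : A}, x ∈ carrier → a * x ∈ carrier
  mul_right_mem : ∀ (a : A) {x : A}, x ∈ carrier → x * a ∈ carrier
  op_mem : ∀ {x : A}, x ∈ carrier → P x ∈ carrier

namespace OperatedIdeal

variable {A : Type*} [NonUnitalRing A] [Module k A] {P : A →ₗ[k] A}

/-- The operated ideal `Id(S)` generated by `S`: the intersection of all operated ideals that
contain `S`. -/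
def gen (P : A →ₗ[k] A) (S : Set A) : OperatedIdeal P where
  toSubmodule := sInf {I | ∃ J : OperatedIdeal P, J.toSubmodule = I ∧ S ⊆ (I : Set A)}
  mul_left_mem a x hx := by
    simp only [AddSubsemigroup.mem_carrier, AddSubmonoid.mem_toSubsemigroup,
      Submodule.mem_toAddSubmonoid, Submodule.mem_sInf] at hx ⊢
    rintro _ ⟨J, rfl, hJ⟩
    exact J.mul_left_mem a (hx _ ⟨J, rfl, hJ⟩)
  mul_right_mem a x hx := by
    simp only [AddSubsemigroup.mem_carrier, AddSubmonoid.mem_toSubsemigroup,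
      Submodule.mem_toAddSubmonoid, Submodule.mem_sInf] at hx ⊢
    rintro _ ⟨J, rfl, hJ⟩
    exact J.mul_right_mem a (hx _ ⟨J, rfl, hJ⟩)
  op_mem {x} hx := by
    simp only [AddSubsemigroup.mem_carrier, AddSubmonoid.mem_toSubsemigroup,
      Submodule.mem_toAddSubmonoid, Submodule.mem_sInf] at hx ⊢
    rintro _ ⟨J, rfl, hJ⟩
    exact J.op_mem (hx _ ⟨J, rfl, hJ⟩)

/-- The quotient of `A` by an operated ideal. -/
def Quot (I : OperatedIdeal P) : Type _ := A ⧸ I.toSubmodule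

variable (I : OperatedIdeal P)

instance : AddCommGroup I.Quot := inferInstanceAs (AddCommGroup (A ⧸ I.toSubmodule))

instance : Module k I.Quot := inferInstanceAs (Module k (A ⧸ I.toSubmodule))

/-- The canonical projection. -/
def proj : A →ₗ[k] I.Quot := I.toSubmodule.mkQ

theorem proj_surjective : Function.Surjective I.proj := I.toSubmodule.mkQ_surjective

theorem proj_eq_proj {a b : A} : I.proj a = I.proj b ↔ a - b ∈ I.toSubmodule :=
  Submodule.Quotient.eq I.toSubmodule

instance : Mul I.Quot where
  mul := Quotient.map₂ (· * ·) (by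
    intro a a' ha b b' hb
    rw [← Quotient.eq_iff_equiv] at ha hb ⊢
    have ha' : a - a' ∈ I.toSubmodule := I.proj_eq_proj.1 ha
    have hb' : b - b' ∈ I.toSubmodule := I.proj_eq_proj.1 hb
    refine I.proj_eq_proj.2 ?_
    have h : a * b - a' * b' = (a - a') * b + a' * (b - b') := by
      rw [sub_mul, mul_sub]; abel
    change a * b - a' * b' ∈ _
    rw [h]
    exact add_mem (I.mul_right_mem b ha') (I.mul_left_mem a' hb'))

theorem proj_mul (a b : A) : I.proj (a * b) = I.proj a * I.proj b := rfl

instance : NonUnitalRing I.Quot where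
  left_distrib a b c := by
    obtain ⟨a, rfl⟩ := I.proj_surjective a
    obtain ⟨b, rfl⟩ := I.proj_surjective b
    obtain ⟨c, rfl⟩ := I.proj_surjective c
    simp only [← map_add, ← proj_mul, mul_add]
  right_distrib a b c := by
    obtain ⟨a, rfl⟩ := I.proj_surjective a
    obtain ⟨b, rfl⟩ := I.proj_surjective b
    obtain ⟨c, rfl⟩ := I.proj_surjective c
    simp only [← map_add, ← proj_mul, add_mul]
  zero_mul a := by
    obtain ⟨a, rfl⟩ := I.proj_surjective a
    rw [← map_zero I.proj, ← proj_mul, zero_mul]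
  mul_zero a := by
    obtain ⟨a, rfl⟩ := I.proj_surjective a
    rw [← map_zero I.proj, ← proj_mul, mul_zero]
  mul_assoc a b c := by
    obtain ⟨a, rfl⟩ := I.proj_surjective a
    obtain ⟨b, rfl⟩ := I.proj_surjective b
    obtain ⟨c, rfl⟩ := I.proj_surjective c
    simp only [← proj_mul, mul_assoc]

instance [IsScalarTower k A A] : IsScalarTower k I.Quot I.Quot where
  smul_assoc c a b := by
    obtain ⟨a, rfl⟩ := I.proj_surjective a
    obtain ⟨b, rfl⟩ := I.proj_surjective b
    simp only [smul_eq_mul, ← map_smul, ← proj_mul, smul_mul_assoc]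

instance [SMulCommClass k A A] : SMulCommClass k I.Quot I.Quot where
  smul_comm c a b := by
    obtain ⟨a, rfl⟩ := I.proj_surjective a
    obtain ⟨b, rfl⟩ := I.proj_surjective b
    simp only [smul_eq_mul, ← map_smul, ← proj_mul, mul_smul_comm]

/-- The operator induced by `P` on the quotient. -/
def op : I.Quot →ₗ[k] I.Quot :=
  I.toSubmodule.mapQ I.toSubmodule P (fun _ hx => I.op_mem hx)

theorem op_proj (a : A) : I.op (I.proj a) = I.proj (P a) := rfl

end OperatedIdeal

/-! ### Modified Rota–Baxter algebras -/

/-- `P` is a modified Rota–Baxter operator of weight `lam` on the nonunitary `k`-algebra `A`. -/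
def IsModifiedRotaBaxter {A : Type*} [NonUnitalRing A] [Module k A] (lam : k) (P : A →ₗ[k] A) :
    Prop :=
  ∀ x y : A, P x * P y = P (P x * y + x * P y) + lam • (x * y)

/-- The word `⌊⌊x⌋y⌋`. -/
def leadWord (x y : BWord X) : BWord X := BWord.br (BWord.br x * y)

/-- The element `⌊⌊x⌋y⌋ + ⌊x⌊y⌋⌋ + λxy - ⌊x⌋⌊y⌋` of `k𝔖(X)`. -/
def mrbElt (lam : k) (x y : BWord X) : WordAlg k X :=
  mon k (leadWord x y) + mon k (BWord.br (x * BWord.br y)) + lam • mon k (x * y)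
    - mon k (BWord.br x * BWord.br y)

/-- The set `S_mrbl` of all these elements. -/
def mrbSet (X : Type*) (lam : k) : Set (WordAlg k X) := {f | ∃ x y : BWord X, f = mrbElt lam x y}

/-- `Irr(S_mrbl)`: the words that are not of the form `q|_⌊⌊x⌋y⌋`. -/
def irrWords (X : Type*) : Set (BWord X) :=
  {w | ¬ ∃ (q : StarWord X) (x y : BWord X), w = q.app (leadWord x y)}

/-- The operated ideal `Id(S_mrbl)` of `k𝔖(X)`. -/
def mrbIdeal (X : Type*) (lam : k) : OperatedIdeal (bracketOp k X) :=
  OperatedIdeal.gen (bracketOp k X) (mrbSet X lam)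

/-- The operated algebra `k𝔖(X)/Id(S_mrbl)`. -/
abbrev FreeMRB (X : Type*) (lam : k) := (mrbIdeal X lam).Quot

end

end MRB

/-! Write E(x,y) for the generator and h for the length of the path of the first letter of x. In
⌊⌊x⌋y⌋ that first path has length h+3, in the three other monomials of E(x,y) at most h+2, and all
four words have equally many letters. Paths are compared by length first, so ⌊⌊x⌋y⌋ leads. The order
itself is not compatible with products: ⌊xy⌋ < ⌊x⌋y, but ⌊xy⌋z > ⌊x⌋yz, because only factors of
breadth one receive a new μ. The stronger relation `PathShorter` does survive brackets and products,
and it gives the leading monomials in every context.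

Leading words have breadth one, so there are no intersection compositions. An including composition
places ⌊⌊u⌋v⌋ inside x, inside y, or at ⌊x⌋ itself. The first two cases follow from bilinearity of
E. In the third, put a∘b = ⌊a⌋b + a⌊b⌋; comparing both bracketings of ⌊u⌋⌊v⌋⌊y⌋ gives E(u∘v,y) +
E(u,v)⌊y⌋ - ⌊E(u,v)y⌋ = E(u,v∘y) + ⌊u⌋E(v,y) - ⌊uE(v,y)⌋, which expresses the composition by smaller
elements.

The basis statement is proved without the composition-diamond lemma. On the span of irreducible
words, `nfOp` defines an operator by solving the identity for ⌊⌊u⌋v⌋, and `nfOpLin_mul` shows that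
it is modified Rota–Baxter there. Evaluating all words with this operator gives a homomorphism
`nfHom` that kills the ideal and fixes irreducible words, hence linear independence. Each word is
congruent to its value (`proj_nf`), hence spanning. The universal property comes from evaluating
words in the target algebra. -/

namespace MRB

namespace BWord

variable {X : Type*}

/-! ### The path order is well-founded -/

theorem degX_pos (u : BWord X) : 0 < degX u := by
  induction u <;> simp only [degX] <;> omega

theorem breadth_pos (u : BWord X) : 0 < breadth u := by
  induction u <;> simp only [breadth] <;> omega

theorem degX_mul (u v : BWord X) : degX (u * v) = degX u + degX v := by
  induction u with
  | var x => rfl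
  | br u _ => rfl
  | varMul x u ih => simp only [varMul_mul, degX, ih, Nat.add_assoc]
  | brMul u w _ ih => simp only [brMul_mul, degX, ih, Nat.add_assoc]

theorem breadth_mul (u v : BWord X) : breadth (u * v) = breadth u + breadth v := by
  induction u with
  | var x => rfl
  | br u _ => rfl
  | varMul x u ih => simp only [varMul_mul, breadth, ih, Nat.add_assoc]
  | brMul u w _ ih => simp only [brMul_mul, breadth, ih, Nat.add_assoc]

/-- The paths of the letters of `u` inside a product that has `u` as a proper factor. -/
def factorPaths (u : BWord X) : List (List (PathAlphabet X)) :=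
  if breadth u = 1 then (pathL u).map (fun p => symMul :: p) else pathL u

theorem pathL_varMul (x : X) (v : BWord X) :
    pathL (varMul x v) = factorPaths (var x) ++ factorPaths v := by
  simp [pathL, factorPaths, breadth]

theorem pathL_brMul (u v : BWord X) :
    pathL (brMul u v) = factorPaths (br u) ++ factorPaths v := by
  simp [pathL, factorPaths, breadth, Function.comp_def]

theorem factorPaths_of_breadth_ne_one {u : BWord X} (h : breadth u ≠ 1) :
    factorPaths u = pathL u := if_neg h

theorem breadth_mul_ne_one (u v : BWord X) : breadth (u * v) ≠ 1 := by
  have := breadth_pos u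
  have := breadth_pos v
  rw [breadth_mul]; omega

theorem pathL_mul (u v : BWord X) : pathL (u * v) = factorPaths u ++ factorPaths v := by
  induction u with
  | var x => exact pathL_varMul x v
  | br u _ => exact pathL_brMul u v
  | varMul x u ih =>
    rw [varMul_mul, pathL_varMul, factorPaths_of_breadth_ne_one (breadth_mul_ne_one u v), ih,
      factorPaths_of_breadth_ne_one (u := varMul x u) (breadth_mul_ne_one (var x) u),
      pathL_varMul, List.append_assoc]
  | brMul w u _ ih =>
    rw [brMul_mul, pathL_brMul, factorPaths_of_breadth_ne_one (breadth_mul_ne_one u v), ih,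
      factorPaths_of_breadth_ne_one (u := brMul w u) (breadth_mul_ne_one (br w) u),
      pathL_brMul, List.append_assoc]

theorem length_factorPaths (u : BWord X) : (factorPaths u).length = (pathL u).length := by
  unfold factorPaths; split <;> simp

theorem length_pathL (u : BWord X) : (pathL u).length = degX u := by
  induction u with
  | var x => rfl
  | br u ih => simpa [pathL, degX] using ih
  | varMul x v ih =>
    rw [pathL_varMul, List.length_append, length_factorPaths, length_factorPaths, ih]; rfl
  | brMul u v ihu ihv =>
    rw [pathL_brMul, List.length_append, length_factorPaths, length_factorPaths, ihv, pathL,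
      List.length_map, ihu]; rfl

/-- There is one path per letter, so comparing degrees is comparing lengths of path lists.
Well-foundedness then reduces to that of an iterated shortlex order. -/
theorem pathLT_iff_shortlex [LinearOrder X] (u v : BWord X) :
    pathLT u v ↔ List.Shortlex (List.Shortlex (· < ·)) (pathL u) (pathL v) := by
  rw [List.shortlex_def, length_pathL, length_pathL, pathLT]

theorem pathLT_wellFounded [LinearOrder X] [WellFoundedLT X] :
    WellFounded (pathLT (X := X)) := by
  have h : WellFounded ((· < ·) : PathAlphabet X → PathAlphabet X → Prop) := wellFounded_lt
  refine Subrelation.wf (fun {u v} huv => ?_)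
    (InvImage.wf pathL (List.Shortlex.wf (List.Shortlex.wf h)))
  exact (pathLT_iff_shortlex u v).1 huv

/-! ### Comparison by the length of one path -/

/-- The length of the path of the first letter. -/
def headLen (u : BWord X) : ℕ := ((pathL u).headD []).length

theorem pathL_ne_nil (u : BWord X) : pathL u ≠ [] := by
  rw [← List.length_pos_iff, length_pathL]
  exact degX_pos u

theorem headLen_br (u : BWord X) : headLen (br u) = headLen u + 1 := by
  have := pathL_ne_nil u
  unfold headLen
  rw [pathL]
  cases h : pathL u <;> simp_all

theorem headLen_mul (u v : BWord X) :
    headLen (u * v) = headLen u + if breadth u = 1 then 1 else 0 := by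
  have := pathL_ne_nil u
  unfold headLen
  rw [pathL_mul, factorPaths]
  cases h : pathL u <;> split <;> simp_all

theorem headLen_mul_le (u v : BWord X) : headLen (u * v) ≤ headLen u + 1 := by
  rw [headLen_mul]; split <;> omega

theorem headLen_br_mul (u v : BWord X) : headLen (br u * v) = headLen u + 2 := by
  rw [headLen_mul, headLen_br]; rfl

/-- The words `u` and `v` have equally many letters, the first pair of different paths is
shorter in `u`, and this persists when both words are extended to larger words. -/
def PathShorter (u v : BWord X) : Prop :=
  degX u = degX v ∧ ∃ l p p' r r', pathL u = l ++ p :: r ∧ pathL v = l ++ p' :: r' ∧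
    p.length < p'.length ∧ ((breadth u = 1 ↔ breadth v = 1) ∨ l = [] ∧ breadth v = 1)

/-- With `breadth v = 1` the larger word always receives the extra μ in a product, so nothing is
needed about the breadth of `u`. -/
theorem PathShorter.of_headLen {u v : BWord X} (hd : degX u = degX v)
    (hl : headLen u < headLen v) (hb : breadth v = 1) : PathShorter u v := by
  refine ⟨hd, [], ?_⟩
  have hu := pathL_ne_nil u
  have hv := pathL_ne_nil v
  unfold headLen at hl
  cases h : pathL u with
  | nil => exact absurd h hu
  | cons p r =>
    cases h' : pathL v with
    | nil => exact absurd h' hv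
    | cons p' r' =>
      rw [h, h'] at hl
      exact ⟨p, p', r, r', rfl, rfl, hl, .inr ⟨rfl, hb⟩⟩

theorem PathShorter.pathLT [LinearOrder X] {u v : BWord X} (h : PathShorter u v) :
    pathLT u v := by
  obtain ⟨hd, l, p, p', r, r', hu, hv, hl, -⟩ := h
  refine .inr ⟨hd, ?_⟩
  rw [hu, hv]
  exact List.Lex.append_left _ (.rel (.of_length_lt hl)) l

theorem PathShorter.br {u v : BWord X} (h : PathShorter u v) : PathShorter (br u) (br v) := by
  obtain ⟨hd, l, p, p', r, r', hu, hv, hl, -⟩ := h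
  exact ⟨hd, l.map (symOp :: ·), symOp :: p, symOp :: p', r.map (symOp :: ·),
    r'.map (symOp :: ·), by simp [pathL, hu], by simp [pathL, hv], by simpa using hl, .inl Iff.rfl⟩

/-- This is what the breadth condition in `PathShorter` is for. If both or neither word is prime,
both or neither gain a μ and the gap is unchanged. -/
theorem PathShorter.exists_factorPaths {u v : BWord X} (h : PathShorter u v) :
    ∃ l p p' r r', factorPaths u = l ++ p :: r ∧ factorPaths v = l ++ p' :: r' ∧
      p.length < p'.length := by
  obtain ⟨-, l, p, p', r, r', hu, hv, hl, h⟩ := h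
  by_cases hv1 : breadth v = 1
  · by_cases hu1 : breadth u = 1
    · exact ⟨l.map (symMul :: ·), symMul :: p, symMul :: p', r.map (symMul :: ·),
        r'.map (symMul :: ·), by simp [factorPaths, hu, hu1], by simp [factorPaths, hv, hv1],
        by simpa using hl⟩
    -- Only `v` gains a μ. This would spoil a common prefix, but the prefix is empty, and the gap
    -- grows by one.
    · obtain ⟨rfl, -⟩ := h.resolve_left fun h => hu1 (h.2 hv1)
      exact ⟨[], p, symMul :: p', r, r'.map (symMul :: ·), by simp [factorPaths, hu, hu1],
        by simp [factorPaths, hv, hv1], by simp; omega⟩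
  · have hu1 : breadth u ≠ 1 := fun hu1 => h.elim (fun h => hv1 (h.1 hu1)) fun h => hv1 h.2
    exact ⟨l, p, p', r, r', by simp [factorPaths, hu, hu1], by simp [factorPaths, hv, hv1], hl⟩

theorem PathShorter.mul_right {u v : BWord X} (h : PathShorter u v) (w : BWord X) :
    PathShorter (u * w) (v * w) := by
  obtain ⟨l, p, p', r, r', hu, hv, hl⟩ := h.exists_factorPaths
  exact ⟨by rw [degX_mul, degX_mul, h.1], l, p, p', r ++ factorPaths w, r' ++ factorPaths w,
    by simp [pathL_mul, hu], by simp [pathL_mul, hv], hl,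
    .inl (by simp [breadth_mul_ne_one])⟩

theorem PathShorter.mul_left {u v : BWord X} (h : PathShorter u v) (w : BWord X) :
    PathShorter (w * u) (w * v) := by
  obtain ⟨l, p, p', r, r', hu, hv, hl⟩ := h.exists_factorPaths
  exact ⟨by rw [degX_mul, degX_mul, h.1], factorPaths w ++ l, p, p', r, r',
    by simp [pathL_mul, hu], by simp [pathL_mul, hv], hl, .inl (by simp [breadth_mul_ne_one])⟩

end BWord

/-! ### Contexts -/

/-- Words with one hole, built from the hole outwards. -/
inductive Ctx (X : Type*) where
  | hole : Ctx X
  | holeMul (v : BWord X) : Ctx X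
  | br (c : Ctx X) : Ctx X
  | varMul (x : X) (c : Ctx X) : Ctx X
  | brCtxMul (c : Ctx X) (v : BWord X) : Ctx X
  | brMulCtx (u : BWord X) (c : Ctx X) : Ctx X

namespace Ctx

variable {X : Type*}

/-- Fill the hole. -/
def app : Ctx X → BWord X → BWord X
  | hole, w => w
  | holeMul v, w => w * v
  | br c, w => .br (c.app w)
  | varMul x c, w => .varMul x (c.app w)
  | brCtxMul c v, w => .brMul (c.app w) v
  | brMulCtx u c, w => .brMul u (c.app w)

end Ctx

namespace BWord

variable {X : Type*}

/-- A word on `X` as a word on `X ⊔ {⋆}`. -/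
def lift : BWord X → BWord (Option X)
  | var x => var (some x)
  | br u => br (lift u)
  | varMul x v => varMul (some x) (lift v)
  | brMul u v => brMul (lift u) (lift v)

theorem starCount_lift (u : BWord X) : starCount (lift u) = 0 := by
  induction u <;> simp_all [lift, starCount]

theorem fill_lift (w u : BWord X) : fill w (lift u) = u := by
  induction u <;> simp_all [lift, fill] <;> rfl

theorem exists_eq_lift (q : BWord (Option X)) (h : starCount q = 0) : ∃ u, q = lift u := by
  induction q with
  | var x =>
    cases x with
    | none => simp [starCount] at h
    | some x => exact ⟨var x, rfl⟩
  | br q ih =>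
    obtain ⟨u, rfl⟩ := ih h
    exact ⟨br u, rfl⟩
  | varMul x q ih =>
    cases x with
    | none => simp [starCount] at h
    | some x =>
      obtain ⟨u, rfl⟩ := ih h
      exact ⟨varMul x u, rfl⟩
  | brMul p q ihp ihq =>
    simp only [starCount, Nat.add_eq_zero_iff] at h
    obtain ⟨u, rfl⟩ := ihp h.1
    obtain ⟨v, rfl⟩ := ihq h.2
    exact ⟨brMul u v, rfl⟩

/-- With a single star, every part beside it is star-free, hence a lifted word that filling leaves
alone; the recursion only follows the star. -/
theorem exists_ctx (q : BWord (Option X)) (h : starCount q = 1) :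
    ∃ c : Ctx X, ∀ w, fill w q = c.app w := by
  induction q with
  | var x =>
    cases x with
    | none => exact ⟨.hole, fun _ => rfl⟩
    | some x => simp [starCount] at h
  | br q ih =>
    obtain ⟨c, hc⟩ := ih h
    exact ⟨.br c, fun w => by rw [fill, hc, Ctx.app]⟩
  | varMul x q ih =>
    cases x with
    | none =>
      simp only [starCount, Nat.add_eq_left] at h
      obtain ⟨u, rfl⟩ := exists_eq_lift q h
      exact ⟨.holeMul u, fun w => by rw [fill, fill_lift, Ctx.app]⟩
    | some x =>
      obtain ⟨c, hc⟩ := ih h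
      exact ⟨.varMul x c, fun w => by rw [fill, hc, Ctx.app, var_mul]⟩
  | brMul p q ihp ihq =>
    simp only [starCount] at h
    rcases Nat.add_eq_one_iff.1 h with ⟨hp, hq⟩ | ⟨hp, hq⟩
    · obtain ⟨u, rfl⟩ := exists_eq_lift p hp
      obtain ⟨c, hc⟩ := ihq hq
      exact ⟨.brMulCtx u c, fun w => by rw [fill, hc, fill_lift, Ctx.app, br_mul]⟩
    · obtain ⟨u, rfl⟩ := exists_eq_lift q hq
      obtain ⟨c, hc⟩ := ihp hp
      exact ⟨.brCtxMul c u, fun w => by rw [fill, hc, fill_lift, Ctx.app, br_mul]⟩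

end BWord

namespace Ctx

variable {X : Type*}

theorem exists_starWord (c : Ctx X) : ∃ q : StarWord X, q.app = c.app := by
  suffices h : ∃ q : BWord (Option X), q.starCount = 1 ∧ ∀ w, BWord.fill w q = c.app w by
    obtain ⟨q, hq, h⟩ := h
    exact ⟨⟨q, hq⟩, funext h⟩
  induction c with
  | hole => exact ⟨.var none, rfl, fun _ => rfl⟩
  | holeMul v =>
    exact ⟨.varMul none v.lift, by rw [BWord.starCount, BWord.starCount_lift],
      fun w => by rw [BWord.fill, BWord.fill_lift, app]⟩
  | br c ih =>
    obtain ⟨q, hq, h⟩ := ih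
    exact ⟨.br q, hq, fun w => by rw [BWord.fill, h, app]⟩
  | varMul x c ih =>
    obtain ⟨q, hq, h⟩ := ih
    exact ⟨.varMul (some x) q, hq, fun w => by rw [BWord.fill, h, app, BWord.var_mul]⟩
  | brCtxMul c v ih =>
    obtain ⟨q, hq, h⟩ := ih
    exact ⟨.brMul q v.lift, by rw [BWord.starCount, BWord.starCount_lift, hq],
      fun w => by rw [BWord.fill, BWord.fill_lift, h, app, BWord.br_mul]⟩
  | brMulCtx u c ih =>
    obtain ⟨q, hq, h⟩ := ih
    exact ⟨.brMul u.lift q, by rw [BWord.starCount, BWord.starCount_lift, hq],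
      fun w => by rw [BWord.fill, BWord.fill_lift, h, app, BWord.br_mul]⟩

theorem pathShorter (c : Ctx X) {u v : BWord X} (h : u.PathShorter v) :
    (c.app u).PathShorter (c.app v) := by
  induction c with
  | hole => exact h
  | holeMul w => exact h.mul_right w
  | br c ih => exact ih.br
  | varMul x c ih => exact ih.mul_left (.var x)
  | brCtxMul c w ih => exact ih.br.mul_right w
  | brMulCtx w c ih => exact ih.mul_left (.br w)

end Ctx

theorem StarWord.exists_ctx {X : Type*} (q : StarWord X) : ∃ c : Ctx X, q.app = c.app := by
  obtain ⟨c, hc⟩ := BWord.exists_ctx q.1 q.2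
  exact ⟨c, funext hc⟩

end MRB
namespace MRB

open MonoidAlgebra

/-! ### Products of contexts with words -/

namespace Ctx

variable {X : Type*}

/-- The context `c w`. -/
def mulRight (w : BWord X) : Ctx X → Ctx X
  | hole => holeMul w
  | holeMul v => holeMul (v * w)
  | br c => brCtxMul c w
  | varMul x c => varMul x (mulRight w c)
  | brCtxMul c v => brCtxMul c (v * w)
  | brMulCtx u c => brMulCtx u (mulRight w c)

theorem mulRight_app (c : Ctx X) (w u : BWord X) : (c.mulRight w).app u = c.app u * w := by
  induction c with
  | hole => rfl
  | holeMul v => exact (mul_assoc u v w).symm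
  | br c _ => rfl
  | varMul x c ih => simp only [mulRight, app, ih]; rfl
  | brCtxMul c v _ => rfl
  | brMulCtx v c ih => simp only [mulRight, app, ih]; rfl

/-- The context `w c`. -/
def mulLeft (c : Ctx X) : BWord X → Ctx X
  | .var x => varMul x c
  | .br u => brMulCtx u c
  | .varMul x v => varMul x (mulLeft c v)
  | .brMul u v => brMulCtx u (mulLeft c v)

theorem mulLeft_app (c : Ctx X) (w u : BWord X) : (c.mulLeft w).app u = w * c.app u := by
  induction w with
  | var x => rfl
  | br v _ => rfl
  | varMul x v ih => simp only [mulLeft, app, ih]; rfl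
  | brMul v v' _ ih => simp only [mulLeft, app, ih]; rfl

end Ctx

section

variable {k : Type*} [CommRing k] {X : Type*}

/-! ### Linear extensions evaluated on words -/

theorem mon_mul_mon (u v : BWord X) : mon k u * mon k v = mon k (u * v) := by
  simp [mon]

theorem mapDomain_mon {Y : Type*} (f : BWord X → BWord Y) (u : BWord X) :
    mapDomain f (mon k u) = mon k (f u) := mapDomain_single

theorem bracketOp_mon (u : BWord X) : bracketOp k X (mon k u) = mon k (.br u) :=
  mapDomainLinearMap_single ..

theorem mapDomain_sub' {Y : Type*} (f : BWord X → BWord Y) (a b : WordAlg k X) :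
    mapDomain f (a - b) = mapDomain f a - mapDomain f b :=
  map_sub (mapDomainLinearMap k k f) a b

theorem mapDomain_mrbElt (f : BWord X → BWord X) (lam : k) (x y : BWord X) :
    mapDomain f (mrbElt lam x y) = mon k (f (leadWord x y)) +
      mon k (f (.br (x * .br y))) + lam • mon k (f (x * y)) - mon k (f (.br x * .br y)) := by
  simp only [mrbElt, mapDomain_sub', mapDomain_add, mapDomain_smul, mapDomain_mon]

/-! ### Leading monomials -/

open BWord in
theorem pathShorter_br_mul_br (x y : BWord X) : (br (x * br y)).PathShorter (leadWord x y) := by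
  refine .of_headLen (by simp only [leadWord, degX, degX_mul]) ?_ rfl
  have := headLen_mul_le x (br y)
  rw [leadWord, headLen_br, headLen_br, headLen_br_mul]
  omega

open BWord in
theorem pathShorter_mul (x y : BWord X) : (x * y).PathShorter (leadWord x y) := by
  refine .of_headLen (by simp only [leadWord, degX, degX_mul]) ?_ rfl
  have := headLen_mul_le x y
  rw [leadWord, headLen_br, headLen_br_mul]
  omega

open BWord in
theorem pathShorter_br_mul (x y : BWord X) : (br x * br y).PathShorter (leadWord x y) := by
  refine .of_headLen (by simp only [leadWord, degX, degX_mul]) ?_ rfl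
  rw [leadWord, headLen_br, headLen_br_mul, headLen_br_mul]
  omega

variable [LinearOrder X] [WellFoundedLT X]

theorem pathLT_irrefl (u : BWord X) : ¬ u.pathLT u :=
  BWord.pathLT_wellFounded.irrefl.irrefl u

theorem IsLeadingMonomial.unique {f : WordAlg k X} {u v : BWord X}
    (hu : IsLeadingMonomial BWord.pathLT f u) (hv : IsLeadingMonomial BWord.pathLT f v) :
    u = v := by
  by_contra h
  exact BWord.pathLT_wellFounded.asymm.asymm _ _ (hu.2 v hv.1 (Ne.symm h)) (hv.2 u hu.1 h)

theorem coeff_lead {a b c d : BWord X} (lam : k) (hb : b.pathLT a) (hc : c.pathLT a)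
    (hd : d.pathLT a) : (mon k a + mon k b + lam • mon k c - mon k d).coeff a = 1 := by
  have hb : b ≠ a := fun h => pathLT_irrefl a (h ▸ hb)
  have hc : c ≠ a := fun h => pathLT_irrefl a (h ▸ hc)
  have hd : d ≠ a := fun h => pathLT_irrefl a (h ▸ hd)
  simp [mon, hb, hc, hd]

theorem isLeadingMonomial_of_lt [Nontrivial k] {a b c d : BWord X} (lam : k) (hb : b.pathLT a)
    (hc : c.pathLT a) (hd : d.pathLT a) :
    IsLeadingMonomial BWord.pathLT (mon k a + mon k b + lam • mon k c - mon k d) a := by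
  refine ⟨by simp [-coeff_add, -coeff_sub, coeff_lead lam hb hc hd], fun v hv hva => ?_⟩
  by_contra hlt
  have h2 : b ≠ v := fun h => hlt (h ▸ hb)
  have h3 : c ≠ v := fun h => hlt (h ▸ hc)
  have h4 : d ≠ v := fun h => hlt (h ▸ hd)
  simp [mon, Ne.symm hva, h2, h3, h4] at hv

theorem isLeadingMonomial_ctx [Nontrivial k] (lam : k) (c : Ctx X) (x y : BWord X) :
    IsLeadingMonomial BWord.pathLT (mapDomain c.app (mrbElt lam x y))
      (c.app (leadWord x y)) := by
  rw [mapDomain_mrbElt]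
  exact isLeadingMonomial_of_lt lam (c.pathShorter (pathShorter_br_mul_br x y)).pathLT
    (c.pathShorter (pathShorter_mul x y)).pathLT (c.pathShorter (pathShorter_br_mul x y)).pathLT

theorem isLeadingMonomial_appLin [Nontrivial k] (lam : k) (q : StarWord X) (x y : BWord X) :
    IsLeadingMonomial BWord.pathLT (q.appLin (mrbElt lam x y)) (q.app (leadWord x y)) := by
  obtain ⟨c, hc⟩ := q.exists_ctx
  rw [StarWord.appLin, hc]
  exact isLeadingMonomial_ctx lam c x y

theorem isLeadingMonomial_mrbElt [Nontrivial k] (lam : k) (x y : BWord X) :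
    IsLeadingMonomial BWord.pathLT (mrbElt lam x y) (leadWord x y) :=
  isLeadingMonomial_of_lt lam (pathShorter_br_mul_br x y).pathLT
    (pathShorter_mul x y).pathLT (pathShorter_br_mul x y).pathLT

/-! ### Compositions -/

theorem isTrivialMod_ctx [Nontrivial k] (lam : k) (c : Ctx X) {w x y : BWord X}
    (h : (c.app (leadWord x y)).pathLT w) :
    IsTrivialMod BWord.pathLT (mrbSet X lam) w (mapDomain c.app (mrbElt lam x y)) := by
  obtain ⟨q, hq⟩ := c.exists_starWord
  exact Submodule.subset_span ⟨q, _, ⟨x, y, rfl⟩, by rw [StarWord.appLin, hq], _,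
    isLeadingMonomial_ctx lam c x y, h⟩

theorem isTrivialMod_mrbElt [Nontrivial k] (lam : k) {w x y : BWord X}
    (h : (leadWord x y).pathLT w) :
    IsTrivialMod BWord.pathLT (mrbSet X lam) w (mrbElt lam x y) := by
  have := isTrivialMod_ctx lam .hole h
  rwa [mapDomain_mrbElt] at this

/-- The case of a leading word inside x. With g = `mrbElt lam u v`, the bilinear extension of E at
(c[g], y) is expanded in two ways: over the monomials of g, and over the four terms of E. Equating
them gives `key`. -/
theorem isTrivialMod_composition_fst [Nontrivial k] (lam : k) (c : Ctx X) (u v y : BWord X) :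
    IsTrivialMod BWord.pathLT (mrbSet X lam) (leadWord (c.app (leadWord u v)) y)
      (mrbElt lam (c.app (leadWord u v)) y -
        mapDomain (Ctx.br (.brCtxMul c y)).app (mrbElt lam u v)) := by
  have key : mrbElt lam (c.app (leadWord u v)) y -
        mapDomain (Ctx.br (.brCtxMul c y)).app (mrbElt lam u v) =
      mapDomain (Ctx.br (c.mulRight (.br y))).app (mrbElt lam u v)
      + lam • mapDomain (c.mulRight y).app (mrbElt lam u v)
      - mapDomain (Ctx.brCtxMul c (.br y)).app (mrbElt lam u v)
      - mrbElt lam (c.app (.br (u * .br v))) y - lam • mrbElt lam (c.app (u * v)) y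
      + mrbElt lam (c.app (.br u * .br v)) y := by
    simp only [mapDomain_mrbElt, Ctx.app, Ctx.mulRight_app, ← BWord.br_mul]
    simp only [mrbElt, leadWord]
    module
  have hc {a : BWord X} (h : a.PathShorter (leadWord u v)) :
      (leadWord (c.app a) y).pathLT (leadWord (c.app (leadWord u v)) y) :=
    ((Ctx.br (.brCtxMul c y)).pathShorter h).pathLT
  rw [key]
  refine add_mem (sub_mem (sub_mem (sub_mem (add_mem ?_ (Submodule.smul_mem _ _ ?_)) ?_) ?_)
    (Submodule.smul_mem _ _ ?_)) ?_
  · refine isTrivialMod_ctx lam _ ?_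
    rw [Ctx.app, Ctx.mulRight_app]
    exact (pathShorter_br_mul_br _ y).pathLT
  · refine isTrivialMod_ctx lam _ ?_
    rw [Ctx.mulRight_app]
    exact (pathShorter_mul _ y).pathLT
  · exact isTrivialMod_ctx lam _ (pathShorter_br_mul _ y).pathLT
  · exact isTrivialMod_mrbElt lam (hc (pathShorter_br_mul_br u v))
  · exact isTrivialMod_mrbElt lam (hc (pathShorter_mul u v))
  · exact isTrivialMod_mrbElt lam (hc (pathShorter_br_mul u v))

/-- The same double expansion, now in the second argument of E. -/
theorem isTrivialMod_composition_snd [Nontrivial k] (lam : k) (c : Ctx X) (x u v : BWord X) :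
    IsTrivialMod BWord.pathLT (mrbSet X lam) (leadWord x (c.app (leadWord u v)))
      (mrbElt lam x (c.app (leadWord u v)) -
        mapDomain (Ctx.br (.brMulCtx x c)).app (mrbElt lam u v)) := by
  have key : mrbElt lam x (c.app (leadWord u v)) -
        mapDomain (Ctx.br (.brMulCtx x c)).app (mrbElt lam u v) =
      mapDomain (Ctx.br ((Ctx.br c).mulLeft x)).app (mrbElt lam u v)
      + lam • mapDomain (c.mulLeft x).app (mrbElt lam u v)
      - mapDomain (Ctx.brMulCtx x (Ctx.br c)).app (mrbElt lam u v)
      - mrbElt lam x (c.app (.br (u * .br v))) - lam • mrbElt lam x (c.app (u * v))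
      + mrbElt lam x (c.app (.br u * .br v)) := by
    simp only [mapDomain_mrbElt, Ctx.app, Ctx.mulLeft_app, ← BWord.br_mul]
    simp only [mrbElt, leadWord]
    module
  have hc {a : BWord X} (h : a.PathShorter (leadWord u v)) :
      (leadWord x (c.app a)).pathLT (leadWord x (c.app (leadWord u v))) :=
    ((Ctx.br (.brMulCtx x c)).pathShorter h).pathLT
  rw [key]
  refine add_mem (sub_mem (sub_mem (sub_mem (add_mem ?_ (Submodule.smul_mem _ _ ?_)) ?_) ?_)
    (Submodule.smul_mem _ _ ?_)) ?_
  · refine isTrivialMod_ctx lam _ ?_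
    rw [Ctx.app, Ctx.mulLeft_app]
    exact (pathShorter_br_mul_br x _).pathLT
  · refine isTrivialMod_ctx lam _ ?_
    rw [Ctx.mulLeft_app]
    exact (pathShorter_mul x _).pathLT
  · exact isTrivialMod_ctx lam _ (pathShorter_br_mul x _).pathLT
  · exact isTrivialMod_mrbElt lam (hc (pathShorter_br_mul_br u v))
  · exact isTrivialMod_mrbElt lam (hc (pathShorter_mul u v))
  · exact isTrivialMod_mrbElt lam (hc (pathShorter_br_mul u v))

/-- The composition of `⌊⌊⌊u⌋v⌋y⌋` with the leading word `⌊⌊u⌋v⌋` in it. -/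
theorem isTrivialMod_composition_overlap [Nontrivial k] (lam : k) (u v y : BWord X) :
    IsTrivialMod BWord.pathLT (mrbSet X lam) (leadWord (.br u * v) y)
      (mrbElt lam (.br u * v) y - mapDomain (Ctx.br (.holeMul y)).app (mrbElt lam u v)) := by
  -- The associativity relation for ⌊u⌋⌊v⌋⌊y⌋, solved for the composition.
  have key : mrbElt lam (.br u * v) y - mapDomain (Ctx.br (.holeMul y)).app (mrbElt lam u v) =
      mrbElt lam u (v * .br y) - mapDomain (Ctx.holeMul (.br y)).app (mrbElt lam u v)
      - mrbElt lam (u * .br v) y + mrbElt lam u (.br v * y)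
      + mapDomain (Ctx.brMulCtx u .hole).app (mrbElt lam v y)
      - mapDomain (Ctx.br (Ctx.hole.mulLeft u)).app (mrbElt lam v y) := by
    simp only [mapDomain_mrbElt, Ctx.app, Ctx.mulLeft_app, ← BWord.br_mul]
    simp only [mrbElt, leadWord, mul_assoc]
    module
  -- In ⌊⌊⌊u⌋v⌋y⌋ the first path is PμPμP followed by the first path of `u`: five extra symbols.
  -- Every leading word on the right of `key` has fewer.
  have hlt {a : BWord X} (hd : a.degX = (leadWord (.br u * v) y).degX)
      (hl : a.headLen < u.headLen + 5) : a.pathLT (leadWord (.br u * v) y) := by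
    refine (BWord.PathShorter.of_headLen hd ?_ rfl).pathLT
    rwa [leadWord, BWord.headLen_br, BWord.headLen_br_mul, BWord.headLen_br_mul]
  have h1 := BWord.headLen_mul_le u (.br v)
  have h2 := BWord.headLen_mul_le u (leadWord v y)
  rw [key]
  refine sub_mem (add_mem (add_mem (sub_mem (sub_mem ?_ ?_) ?_) ?_) ?_) ?_
  · refine isTrivialMod_mrbElt lam (hlt ?_ ?_)
    · simp only [leadWord, BWord.degX, BWord.degX_mul]; omega
    · simp only [leadWord, BWord.headLen_br, BWord.headLen_br_mul]; omega
  · refine isTrivialMod_ctx lam _ (hlt ?_ ?_) <;> rw [Ctx.app]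
    · simp only [leadWord, BWord.degX, BWord.degX_mul]
    · refine (BWord.headLen_mul_le _ _).trans_lt ?_
      simp only [leadWord, BWord.headLen_br, BWord.headLen_br_mul]; omega
  · refine isTrivialMod_mrbElt lam (hlt ?_ ?_)
    · simp only [leadWord, BWord.degX, BWord.degX_mul]
    · simp only [leadWord, BWord.headLen_br, BWord.headLen_br_mul]; omega
  · refine isTrivialMod_mrbElt lam (hlt ?_ ?_)
    · simp only [leadWord, BWord.degX, BWord.degX_mul]; omega
    · simp only [leadWord, BWord.headLen_br, BWord.headLen_br_mul]; omega
  · refine isTrivialMod_ctx lam _ (hlt ?_ ?_) <;> rw [Ctx.app, Ctx.app, ← BWord.br_mul]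
    · simp only [leadWord, BWord.degX, BWord.degX_mul]; omega
    · rw [BWord.headLen_br_mul]; omega
  · refine isTrivialMod_ctx lam _ (hlt ?_ ?_) <;> rw [Ctx.app, Ctx.mulLeft_app, Ctx.app]
    · simp only [leadWord, BWord.degX, BWord.degX_mul]; omega
    · rw [BWord.headLen_br]; omega

/-- Matching constructors of the context against ⌊⌊x⌋y⌋ leaves four positions: the whole word (zero
composition), the prime ⌊x⌋, inside x, and inside y. -/
theorem isTrivialMod_including [Nontrivial k] (lam : k) (c : Ctx X) {x y u v : BWord X}
    (h : leadWord x y = c.app (leadWord u v)) :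
    IsTrivialMod BWord.pathLT (mrbSet X lam) (leadWord x y)
      (mrbElt lam x y - mapDomain c.app (mrbElt lam u v)) := by
  cases c with
  | hole =>
    obtain ⟨rfl, rfl⟩ : x = u ∧ y = v := by simpa [leadWord, BWord.br_mul, Ctx.app] using h
    rw [mapDomain_mrbElt]
    simp only [Ctx.app]
    rw [← mrbElt, sub_self]
    exact zero_mem _
  | br c =>
    rw [leadWord, Ctx.app, BWord.br.injEq] at h
    cases c with
    | hole => cases h
    | holeMul z =>
      obtain ⟨rfl, rfl⟩ : x = .br u * v ∧ y = z := by
        simpa [leadWord, BWord.br_mul, Ctx.app] using h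
      exact isTrivialMod_composition_overlap lam u v y
    | br c => cases h
    | varMul a c => cases h
    | brCtxMul c z =>
      obtain ⟨rfl, rfl⟩ : x = c.app (leadWord u v) ∧ y = z := by
        simpa [BWord.br_mul, Ctx.app] using h
      exact isTrivialMod_composition_fst lam c u v y
    | brMulCtx z c =>
      obtain ⟨rfl, rfl⟩ : x = z ∧ y = c.app (leadWord u v) := by
        simpa [BWord.br_mul, Ctx.app] using h
      exact isTrivialMod_composition_snd lam c x u v
  | holeMul z => cases h
  | varMul a c => cases h
  | brCtxMul c z => cases h
  | brMulCtx z c => cases h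

theorem isGroebnerShirshov_mrbSet [Nontrivial k] (lam : k) :
    IsGroebnerShirshov BWord.pathLT (mrbSet X lam) := by
  constructor
  · rintro _ ⟨x, y, rfl⟩
    exact ⟨_, isLeadingMonomial_mrbElt lam x y, coeff_lead lam (pathShorter_br_mul_br x y).pathLT
      (pathShorter_mul x y).pathLT (pathShorter_br_mul x y).pathLT⟩
  · rintro _ ⟨x, y, rfl⟩ _ ⟨u, v, rfl⟩ a b ha hb
    obtain rfl := ha.unique (isLeadingMonomial_mrbElt lam x y)
    obtain rfl := hb.unique (isLeadingMonomial_mrbElt lam u v)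
    constructor
    -- Both leading words have breadth one, and no breadth lies strictly between 1 and 2.
    · intro s t w _ _ h1 h2
      simp only [leadWord, BWord.breadth] at h1 h2
      omega
    · rintro q w rfl hw
      obtain ⟨c, hc⟩ := q.exists_ctx
      rw [hc] at hw
      rw [StarWord.appLin, hc]
      exact isTrivialMod_including lam c hw

end

end MRB
namespace MRB

open MonoidAlgebra

/-! ### Irreducible words -/

namespace BWord

variable {X : Type*}

/-- `⌊u⌋` is not of the form `⌊⌊x⌋y⌋`, that is, `u` is not `⌊x⌋y`. -/
def NotBrMul : BWord X → Prop
  | brMul _ _ => False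
  | _ => True

/-- No bracket in the word has the form `⌊⌊x⌋y⌋`. -/
def IsIrr : BWord X → Prop
  | var _ => True
  | br u => u.IsIrr ∧ u.NotBrMul
  | varMul _ v => v.IsIrr
  | brMul u v => (u.IsIrr ∧ u.NotBrMul) ∧ v.IsIrr

/-- The forbidden pattern is a single bracket, so irreducibility is tested prime by prime. -/
theorem isIrr_mul {u v : BWord X} : (u * v).IsIrr ↔ u.IsIrr ∧ v.IsIrr := by
  induction u with
  | var x => simp [var_mul, IsIrr]
  | br u _ => simp [br_mul, IsIrr]
  | varMul x u ih => simp [varMul_mul, IsIrr, ih]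
  | brMul u w _ ih => simp [brMul_mul, IsIrr, ih, and_assoc]

theorem not_isIrr_app (c : Ctx X) (x y : BWord X) : ¬ (c.app (leadWord x y)).IsIrr := by
  have h : ¬ (leadWord x y).IsIrr := by simp [leadWord, br_mul, IsIrr, NotBrMul]
  induction c with
  | hole => exact h
  | holeMul v => exact fun hc => h (isIrr_mul.1 hc).1
  | br c ih => exact fun hc => ih hc.1
  | varMul x c ih => exact ih
  | brCtxMul c v ih => exact fun hc => ih hc.1.1
  | brMulCtx u c ih => exact fun hc => ih hc.2

theorem exists_app_of_not_isIrr (w : BWord X) (h : ¬ w.IsIrr) :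
    ∃ (c : Ctx X) (x y : BWord X), w = c.app (leadWord x y) := by
  have hbr (u : BWord X) (hu : ¬ u.NotBrMul) : ∃ x y, br u = leadWord x y := by
    cases u <;> simp [NotBrMul] at hu
    exact ⟨_, _, rfl⟩
  induction w with
  | var x => exact absurd trivial h
  | br u ih =>
    by_cases hu : u.IsIrr
    · obtain ⟨x, y, hxy⟩ := hbr u fun h' => h ⟨hu, h'⟩
      exact ⟨.hole, x, y, hxy⟩
    · obtain ⟨c, x, y, rfl⟩ := ih hu
      exact ⟨.br c, x, y, rfl⟩
  | varMul a v ih =>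
    obtain ⟨c, x, y, rfl⟩ := ih h
    exact ⟨.varMul a c, x, y, rfl⟩
  | brMul u v ihu ihv =>
    by_cases hv : v.IsIrr
    · by_cases hu : u.IsIrr
      · obtain ⟨x, y, hxy⟩ := hbr u fun h' => h ⟨⟨hu, h'⟩, hv⟩
        exact ⟨.holeMul v, x, y, by rw [Ctx.app, ← hxy, br_mul]⟩
      · obtain ⟨c, x, y, rfl⟩ := ihu hu
        exact ⟨.brCtxMul c v, x, y, rfl⟩
    · obtain ⟨c, x, y, rfl⟩ := ihv hv
      exact ⟨.brMulCtx u c, x, y, rfl⟩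

end BWord

theorem mem_irrWords {X : Type*} {w : BWord X} : w ∈ irrWords X ↔ w.IsIrr := by
  constructor
  · intro h
    by_contra hw
    obtain ⟨c, x, y, rfl⟩ := BWord.exists_app_of_not_isIrr w hw
    obtain ⟨q, hq⟩ := c.exists_starWord
    exact h ⟨q, x, y, by rw [hq]⟩
  · rintro h ⟨q, x, y, rfl⟩
    obtain ⟨c, hc⟩ := q.exists_ctx
    rw [hc] at h
    exact BWord.not_isIrr_app c x y h

noncomputable section

variable {k : Type*} [CommRing k] {X : Type*}

/-! ### Linear extension from words -/

/-- The linear map with prescribed values on words. -/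
def extend {M : Type*} [AddCommGroup M] [Module k M] (f : BWord X → M) : WordAlg k X →ₗ[k] M :=
  (MonoidAlgebra.basis (BWord X) k).constr k f

theorem extend_mon {M : Type*} [AddCommGroup M] [Module k M] (f : BWord X → M) (w : BWord X) :
    extend f (mon k w) = f w := by
  simpa [mon, extend] using (MonoidAlgebra.basis (BWord X) k).constr_basis k f w

theorem extend_apply {M : Type*} [AddCommGroup M] [Module k M] (f : BWord X → M)
    (a : WordAlg k X) : extend f a = a.coeff.sum fun w c => c • f w := by
  rw [extend, Module.Basis.constr_apply]
  rfl

/-- The linear combinations of the words in `s`. -/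
def wordSpan (k : Type*) [CommRing k] {X : Type*} (s : Set (BWord X)) :
    Submodule k (WordAlg k X) :=
  Submodule.span k (mon k '' s)

theorem mon_mem_wordSpan {s : Set (BWord X)} {w : BWord X} (h : w ∈ s) :
    mon k w ∈ wordSpan k s := Submodule.subset_span ⟨w, h, rfl⟩

theorem wordSpan_mono {s t : Set (BWord X)} (h : s ⊆ t) : wordSpan k s ≤ wordSpan k t :=
  Submodule.span_mono (Set.image_mono h)

theorem wordSpan_univ : wordSpan k (Set.univ : Set (BWord X)) = ⊤ := by
  rw [wordSpan, Set.image_univ, eq_top_iff, ← (MonoidAlgebra.basis (BWord X) k).span_eq]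
  exact Submodule.span_mono (by rintro _ ⟨w, rfl⟩; exact ⟨w, by simp [mon]⟩)

theorem map_mem_of_mem_wordSpan {M : Type*} [AddCommGroup M] [Module k M] {s : Set (BWord X)}
    {N : Submodule k M} {f : WordAlg k X →ₗ[k] M} (h : ∀ w ∈ s, f (mon k w) ∈ N)
    {a : WordAlg k X} (ha : a ∈ wordSpan k s) : f a ∈ N := by
  have : wordSpan k s ≤ N.comap f := Submodule.span_le.2 (by rintro _ ⟨w, hw, rfl⟩; exact h w hw)
  exact this ha

theorem eqOn_wordSpan {M : Type*} [AddCommGroup M] [Module k M] {s : Set (BWord X)}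
    {f g : WordAlg k X →ₗ[k] M} (h : ∀ w ∈ s, f (mon k w) = g (mon k w))
    {a : WordAlg k X} (ha : a ∈ wordSpan k s) : f a = g a :=
  LinearMap.eqOn_span (by rintro _ ⟨w, hw, rfl⟩; exact h w hw) ha

theorem linearMap_ext_mon {M : Type*} [AddCommGroup M] [Module k M]
    {f g : WordAlg k X →ₗ[k] M} (h : ∀ w, f (mon k w) = g (mon k w)) : f = g :=
  (MonoidAlgebra.basis (BWord X) k).ext fun w => by simpa [mon] using h w

theorem mul_mem_wordSpan {s t r : Set (BWord X)} (h : ∀ u ∈ s, ∀ v ∈ t, u * v ∈ r)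
    {a b : WordAlg k X} (ha : a ∈ wordSpan k s) (hb : b ∈ wordSpan k t) :
    a * b ∈ wordSpan k r := by
  refine map_mem_of_mem_wordSpan (f := LinearMap.mulRight k b) (fun u hu => ?_) ha
  refine map_mem_of_mem_wordSpan (f := LinearMap.mulLeft k (mon k u)) (fun v hv => ?_) hb
  rw [LinearMap.mulLeft_apply, mon_mul_mon]
  exact mon_mem_wordSpan (h u hu v hv)

/-! ### The operator on irreducible words -/

open Classical in
/-- The normal form of `⌊w⌋` for irreducible `w`, by recursion along
`⌊⌊u⌋v⌋ = ⌊u⌋⌊v⌋ - ⌊u⌊v⌋⌋ - λ u v`. -/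
def nfOp (lam : k) : BWord X → WordAlg k X
  | .var x => mon k (.br (.var x))
  | .br u => mon k (.br (.br u))
  | .varMul x v => mon k (.br (.varMul x v))
  | .brMul u v => mon k (.br u) * nfOp lam v
      - (nfOp lam v).coeff.sum
          -- The guard serves termination only: for irreducible `v`, `nfOp_mem` shows that it always
          -- holds on the support.
          (fun w c => if _h : w.degX = v.degX then c • nfOp lam (u * w) else 0)
      - lam • mon k (u * v)
termination_by w => (w.degX, w.headLen)
decreasing_by
  · refine Prod.Lex.left _ _ ?_
    have := u.degX_pos
    rw [BWord.degX]; omega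
  -- The degree is unchanged, but the first path of uw is at most one symbol longer than that of u,
  -- against two in ⌊u⌋v.
  · refine Prod.Lex.right' _ ?_ ?_
    · rw [BWord.degX_mul, BWord.degX]; omega
    · have := u.headLen_mul_le w
      rw [← BWord.br_mul, BWord.headLen_br_mul]; omega

/-- The linear extension of `nfOp`. -/
def nfOpLin (X : Type*) (lam : k) : WordAlg k X →ₗ[k] WordAlg k X := extend (nfOp lam)

theorem nfOpLin_mon (lam : k) (w : BWord X) : nfOpLin X lam (mon k w) = nfOp lam w :=
  extend_mon _ w

theorem nfOp_of_notBrMul (lam : k) {w : BWord X} (h : w.NotBrMul) :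
    nfOp lam w = mon k (.br w) := by
  cases w with
  | brMul u v => exact h.elim
  | _ => rw [nfOp]

/-- The degree condition is a hypothesis here so that the unguarded recursion is available in the
induction that establishes it, `nfOp_mem`. -/
theorem nfOp_brMul_of_mem (lam : k) {u v : BWord X} {s : Set (BWord X)}
    (hs : ∀ w ∈ s, w.degX = v.degX) (hv : nfOp lam v ∈ wordSpan k s) :
    nfOp lam (.brMul u v) = mon k (.br u) * nfOp lam v
      - nfOpLin X lam (mon k u * nfOp lam v) - lam • mon k (u * v) := by
  classical
  rw [nfOp]
  congr 2
  trans extend (fun w => if w.degX = v.degX then nfOp lam (u * w) else 0) (nfOp lam v)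
  · rw [extend_apply]
    refine Finsupp.sum_congr fun w _ => ?_
    split <;> simp
  · refine eqOn_wordSpan (g := nfOpLin X lam ∘ₗ LinearMap.mulLeft k (mon k u)) (fun w hw => ?_) hv
    rw [extend_mon, if_pos (hs w hw), LinearMap.comp_apply, LinearMap.mulLeft_apply, mon_mul_mon,
      nfOpLin_mon]

/-- The irreducible words with `n` letters. -/
def irrDeg (X : Type*) (n : ℕ) : Set (BWord X) := {w | w.IsIrr ∧ w.degX = n}

/-- An induction principle for irreducible words adapted to `nfOp`. -/
theorem irr_induction {p : BWord X → Prop}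
    (h1 : ∀ u, u.IsIrr → u.NotBrMul → p u)
    (h2 : ∀ u v, u.IsIrr → u.NotBrMul → v.IsIrr → p v →
      (∀ w ∈ irrDeg X v.degX, p (u * w)) → p (.brMul u v))
    (w : BWord X) (hw : w.IsIrr) : p w := by
  have hwf : WellFounded (InvImage (Prod.Lex (· < ·) (· < ·))
    fun w : BWord X => (w.degX, w.headLen)) := InvImage.wf _ (wellFounded_lt.prod_lex wellFounded_lt)
  induction w using hwf.induction with
  | _ w ih =>
    cases w with
    | brMul u v =>
      obtain ⟨⟨hu, hu'⟩, hv⟩ := hw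
      have hpos := u.degX_pos
      refine h2 u v hu hu' hv (ih v (.left _ _ ?_) hv) fun w hw =>
        ih _ (Prod.Lex.right' _ ?_ ?_) (BWord.isIrr_mul.2 ⟨hu, hw.1⟩)
      · rw [BWord.degX]; omega
      · rw [BWord.degX_mul, BWord.degX, hw.2]
      · have := u.headLen_mul_le w
        rw [← BWord.br_mul, BWord.headLen_br_mul]; omega
    | _ => exact h1 _ hw trivial

theorem nfOp_mem (lam : k) (w : BWord X) (hw : w.IsIrr) :
    nfOp lam w ∈ wordSpan k (irrDeg X w.degX) := by
  revert w hw
  refine irr_induction (fun u hu hu' => ?_) (fun u v hu hu' hv ihv ih => ?_)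
  · rw [nfOp_of_notBrMul lam hu']
    exact mon_mem_wordSpan ⟨⟨hu, hu'⟩, rfl⟩
  · rw [nfOp_brMul_of_mem lam (fun w hw => hw.2) ihv]
    refine sub_mem (sub_mem ?_ ?_) (Submodule.smul_mem _ _ (mon_mem_wordSpan ?_))
    · refine mul_mem_wordSpan (s := {.br u}) ?_ (mon_mem_wordSpan rfl) ihv
      rintro _ rfl w hw
      exact ⟨BWord.isIrr_mul.2 ⟨⟨hu, hu'⟩, hw.1⟩, by rw [BWord.degX_mul, hw.2]; rfl⟩
    · refine map_mem_of_mem_wordSpan (f := nfOpLin X lam ∘ₗ LinearMap.mulLeft k (mon k u))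
        (fun w hw => ?_) ihv
      rw [LinearMap.comp_apply, LinearMap.mulLeft_apply, mon_mul_mon, nfOpLin_mon]
      have := ih w hw
      rwa [BWord.degX_mul, hw.2] at this
    · exact ⟨BWord.isIrr_mul.2 ⟨hu, hv⟩, BWord.degX_mul u v⟩

theorem nfOp_brMul (lam : k) (u : BWord X) {v : BWord X} (hv : v.IsIrr) :
    nfOp lam (.brMul u v) = mon k (.br u) * nfOp lam v
      - nfOpLin X lam (mon k u * nfOp lam v) - lam • mon k (u * v) :=
  nfOp_brMul_of_mem lam (fun _ hw => hw.2) (nfOp_mem lam v hv)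

/-- The linear combinations of irreducible words. -/
def irrSpan (k : Type*) [CommRing k] (X : Type*) : Submodule k (WordAlg k X) :=
  wordSpan k {w | w.IsIrr}

theorem mon_mem_irrSpan {w : BWord X} (h : w.IsIrr) : mon k w ∈ irrSpan k X :=
  mon_mem_wordSpan h

theorem mul_mem_irrSpan {a b : WordAlg k X} (ha : a ∈ irrSpan k X) (hb : b ∈ irrSpan k X) :
    a * b ∈ irrSpan k X :=
  mul_mem_wordSpan (fun _ hu _ hv => BWord.isIrr_mul.2 ⟨hu, hv⟩) ha hb

theorem nfOpLin_mem (lam : k) {a : WordAlg k X} (ha : a ∈ irrSpan k X) :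
    nfOpLin X lam a ∈ irrSpan k X := by
  refine map_mem_of_mem_wordSpan (fun w hw => ?_) ha
  rw [nfOpLin_mon]
  exact wordSpan_mono (fun _ h => h.1) (nfOp_mem lam w hw)

theorem nfOpLin_br_mul (lam : k) (u : BWord X) {a : WordAlg k X} (ha : a ∈ irrSpan k X) :
    nfOpLin X lam (mon k (.br u) * a) = mon k (.br u) * nfOpLin X lam a
      - nfOpLin X lam (mon k u * nfOpLin X lam a) - lam • (mon k u * a) := by
  let L (c : WordAlg k X) := LinearMap.mulLeft k c
  let P := nfOpLin X lam
  refine eqOn_wordSpan (f := P ∘ₗ L (mon k (.br u)))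
    (g := L (mon k (.br u)) ∘ₗ P - P ∘ₗ L (mon k u) ∘ₗ P - lam • L (mon k u)) (fun w hw => ?_) ha
  simp only [L, P, LinearMap.comp_apply, LinearMap.sub_apply, LinearMap.smul_apply,
    LinearMap.mulLeft_apply, mon_mul_mon, nfOpLin_mon, BWord.br_mul]
  exact nfOp_brMul lam u hw

/-- The modified Rota–Baxter identity for `nfOpLin` with an irreducible word on the left. -/
theorem nfOpLin_mon_mul (lam : k) (w : BWord X) (hw : w.IsIrr) :
    ∀ b ∈ irrSpan k X, nfOpLin X lam (mon k w) * nfOpLin X lam b =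
      nfOpLin X lam (nfOpLin X lam (mon k w) * b + mon k w * nfOpLin X lam b)
        + lam • (mon k w * b) := by
  revert w hw
  refine irr_induction (fun u hu hu' => ?_) (fun u v hu hu' hv ihv ih => ?_)
  · intro b hb
    -- Here the operator just brackets `u`, and the identity is the recursion for ⌊u⌋b rearranged.
    rw [nfOpLin_mon, nfOp_of_notBrMul lam hu', map_add, nfOpLin_br_mul lam u hb]
    abel
  · intro b hb
    have hPb := nfOpLin_mem lam hb
    have hv' := mon_mem_irrSpan (k := k) hv
    have hu1 := mon_mem_irrSpan (k := k) hu
    have hPv := nfOpLin_mem lam hv'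
    -- The normal form of ⌊v⌋ is a combination of words in `irrDeg X v.degX`, so the hypothesis on
    -- the words uw extends linearly to it.
    have ih' : nfOpLin X lam (mon k u * nfOpLin X lam (mon k v)) * nfOpLin X lam b =
        nfOpLin X lam (nfOpLin X lam (mon k u * nfOpLin X lam (mon k v)) * b
          + mon k u * nfOpLin X lam (mon k v) * nfOpLin X lam b)
        + lam • (mon k u * nfOpLin X lam (mon k v) * b) := by
      let L (c : WordAlg k X) := LinearMap.mulLeft k c
      let R (c : WordAlg k X) := LinearMap.mulRight k c
      let P := nfOpLin X lam
      refine eqOn_wordSpan (s := irrDeg X v.degX) (f := R (P b) ∘ₗ P ∘ₗ L (mon k u))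
        (g := P ∘ₗ (R b ∘ₗ P ∘ₗ L (mon k u) + R (P b) ∘ₗ L (mon k u)) + lam • R b ∘ₗ L (mon k u))
        (fun w hw => ?_) (by rw [nfOpLin_mon]; exact nfOp_mem lam v hv)
      simp only [L, R, P, LinearMap.comp_apply, LinearMap.add_apply, LinearMap.smul_apply,
        LinearMap.mulLeft_apply, LinearMap.mulRight_apply, mon_mul_mon]
      exact ih w hw b hb
    have ihv' := ihv b hb
    have e1 := nfOpLin_br_mul lam u hv'
    have e2 := nfOpLin_br_mul lam u (mul_mem_irrSpan hPv hb)
    have e3 := nfOpLin_br_mul lam u (mul_mem_irrSpan hv' hPb)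
    rw [← BWord.br_mul, ← mon_mul_mon, e1]
    generalize nfOpLin X lam (mon k v) = Pv at *
    generalize nfOpLin X lam b = Pb at *
    generalize nfOpLin X lam (mon k u * Pv) = PuPv at *
    generalize mon k (.br u) = U at *
    generalize mon k u = a at *
    generalize mon k v = v at *
    simp only [sub_mul, smul_mul_assoc, mul_assoc, map_add, map_sub, map_smul, ih', e2, e3, ihv',
      mul_add, mul_smul_comm]
    abel

theorem nfOpLin_mul (lam : k) {a b : WordAlg k X} (ha : a ∈ irrSpan k X) (hb : b ∈ irrSpan k X) :
    nfOpLin X lam a * nfOpLin X lam b =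
      nfOpLin X lam (nfOpLin X lam a * b + a * nfOpLin X lam b) + lam • (a * b) := by
  let R (c : WordAlg k X) := LinearMap.mulRight k c
  let P := nfOpLin X lam
  refine eqOn_wordSpan (f := R (P b) ∘ₗ P) (g := P ∘ₗ (R b ∘ₗ P + R (P b)) + lam • R b)
    (fun w hw => ?_) ha
  exact nfOpLin_mon_mul lam w hw b hb

end

end MRB
namespace MRB

open MonoidAlgebra

/-! ### Generated ideals, kernels and induced homomorphisms -/

namespace OperatedIdeal

variable {k : Type*} [CommRing k] {A : Type*} [NonUnitalRing A] [Module k A] {P : A →ₗ[k] A}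

theorem subset_gen {S : Set A} {x : A} (hx : x ∈ S) : x ∈ (gen P S).toSubmodule := by
  refine Submodule.mem_sInf.2 ?_
  rintro _ ⟨J, rfl, hJ⟩
  exact hJ hx

theorem gen_le {S : Set A} (J : OperatedIdeal P) (hJ : S ⊆ (J.toSubmodule : Set A)) :
    (gen P S).toSubmodule ≤ J.toSubmodule :=
  fun _ hx => Submodule.mem_sInf.1 hx _ ⟨J, rfl, hJ⟩

variable {B : Type*} [NonUnitalRing B] [Module k B]

/-- The kernel of a homomorphism of operated algebras. -/
def ker (f : A →ₙₐ[k] B) (Q : B →ₗ[k] B) (h : ∀ a, f (P a) = Q (f a)) : OperatedIdeal P where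
  toSubmodule := LinearMap.ker (f : A →ₗ[k] B)
  mul_left_mem a x hx := by
    change f x = 0 at hx
    change f (a * x) = 0
    rw [map_mul, hx, mul_zero]
  mul_right_mem a x hx := by
    change f x = 0 at hx
    change f (x * a) = 0
    rw [map_mul, hx, zero_mul]
  op_mem {x} hx := by
    change f x = 0 at hx
    change f (P x) = 0
    rw [h, hx, map_zero]

theorem eq_zero_of_mem_gen (f : A →ₙₐ[k] B) (Q : B →ₗ[k] B) (h : ∀ a, f (P a) = Q (f a))
    {S : Set A} (hS : ∀ s ∈ S, f s = 0) {x : A} (hx : x ∈ (gen P S).toSubmodule) : f x = 0 :=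
  gen_le (ker f Q h) hS hx

/-- The homomorphism on the quotient induced by one that vanishes on the ideal. -/
def liftHom (I : OperatedIdeal P) (f : A →ₙₐ[k] B) (h : ∀ x ∈ I.toSubmodule, f x = 0) :
    I.Quot →ₙₐ[k] B where
  toFun := I.toSubmodule.liftQ (f : A →ₗ[k] B) h
  map_smul' c x := map_smul (I.toSubmodule.liftQ (f : A →ₗ[k] B) h) c x
  map_zero' := map_zero (I.toSubmodule.liftQ (f : A →ₗ[k] B) h)
  map_add' x y := map_add (I.toSubmodule.liftQ (f : A →ₗ[k] B) h) x y
  map_mul' x y := by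
    obtain ⟨x, rfl⟩ := I.proj_surjective x
    obtain ⟨y, rfl⟩ := I.proj_surjective y
    exact map_mul f x y

theorem liftHom_proj (I : OperatedIdeal P) (f : A →ₙₐ[k] B) (h : ∀ x ∈ I.toSubmodule, f x = 0)
    (a : A) : I.liftHom f h (I.proj a) = f a := rfl

end OperatedIdeal

noncomputable section

variable {k : Type*} [CommRing k] {X : Type*}

/-! ### Evaluation of words in an operated algebra -/

section Eval

variable {A : Type*} [NonUnitalRing A] [Module k A] (P : A →ₗ[k] A) (φ : X → A)

/-- The value of a word in an algebra with operator `P` under an assignment of the letters. -/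
def evalWord : BWord X → A
  | .var x => φ x
  | .br u => P (evalWord u)
  | .varMul x v => φ x * evalWord v
  | .brMul u v => P (evalWord u) * evalWord v

theorem evalWord_mul (u v : BWord X) :
    evalWord P φ (u * v) = evalWord P φ u * evalWord P φ v := by
  induction u with
  | var x => rfl
  | br u _ => rfl
  | varMul x u ih => simp only [BWord.varMul_mul, evalWord, ih, mul_assoc]
  | brMul u w _ ih => simp only [BWord.brMul_mul, evalWord, ih, mul_assoc]

variable [IsScalarTower k A A] [SMulCommClass k A A]

/-- The homomorphism of operated algebras on `k𝔖(X)` with given values on the letters. -/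
def evalHom : WordAlg k X →ₙₐ[k] A :=
  liftMagma k ⟨evalWord P φ, evalWord_mul P φ⟩

theorem evalHom_mon (w : BWord X) : evalHom P φ (mon k w) = evalWord P φ w := by
  simp [evalHom, mon]

theorem evalHom_bracketOp (a : WordAlg k X) :
    evalHom P φ (bracketOp k X a) = P (evalHom P φ a) := by
  have : (evalHom P φ : WordAlg k X →ₗ[k] A) ∘ₗ bracketOp k X =
      P ∘ₗ (evalHom P φ : WordAlg k X →ₗ[k] A) := linearMap_ext_mon fun w => by
    change evalHom P φ (bracketOp k X (mon k w)) = P (evalHom P φ (mon k w))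
    rw [bracketOp_mon, evalHom_mon, evalHom_mon, evalWord]
  exact LinearMap.congr_fun this a

/-- The identity is required only at values of words, since `nfOpLin` is known to satisfy it only on
`irrSpan`. -/
theorem evalHom_mrbElt (lam : k) (x y : BWord X)
    (h : P (evalWord P φ x) * P (evalWord P φ y) =
      P (P (evalWord P φ x) * evalWord P φ y + evalWord P φ x * P (evalWord P φ y))
        + lam • (evalWord P φ x * evalWord P φ y)) :
    evalHom P φ (mrbElt lam x y) = 0 := by
  simp only [mrbElt, leadWord, map_sub, map_add, map_smul, evalHom_mon, evalWord, evalWord_mul, h]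
  abel

theorem evalHom_eq_zero {lam : k}
    (h : ∀ x y : BWord X, evalHom P φ (mrbElt lam x y) = 0) {a : WordAlg k X}
    (ha : a ∈ (mrbIdeal X lam).toSubmodule) : evalHom P φ a = 0 := by
  refine OperatedIdeal.eq_zero_of_mem_gen _ P (evalHom_bracketOp P φ) ?_ ha
  rintro _ ⟨x, y, rfl⟩
  exact h x y

end Eval

/-! ### The free modified Rota–Baxter algebra -/

theorem isModifiedRotaBaxter_op (lam : k) :
    IsModifiedRotaBaxter lam (mrbIdeal X lam).op := by
  intro a b
  obtain ⟨a, rfl⟩ := (mrbIdeal X lam).proj_surjective a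
  obtain ⟨b, rfl⟩ := (mrbIdeal X lam).proj_surjective b
  change (mrbIdeal X lam).proj (bracketOp k X a * bracketOp k X b) = (mrbIdeal X lam).proj
    (bracketOp k X (bracketOp k X a * b + a * bracketOp k X b) + lam • (a * b))
  rw [OperatedIdeal.proj_eq_proj]
  let L (c : WordAlg k X) := LinearMap.mulLeft k c
  let R (c : WordAlg k X) := LinearMap.mulRight k c
  let Q := bracketOp k X
  have ha : a ∈ wordSpan k Set.univ := wordSpan_univ (k := k) (X := X) ▸ Submodule.mem_top
  have hb : b ∈ wordSpan k Set.univ := wordSpan_univ (k := k) (X := X) ▸ Submodule.mem_top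
  refine map_mem_of_mem_wordSpan (f := R (Q b) ∘ₗ Q - (Q ∘ₗ (R b ∘ₗ Q + R (Q b)) + lam • R b))
    (fun x _ => ?_) ha
  refine map_mem_of_mem_wordSpan (f := L (Q (mon k x)) ∘ₗ Q -
    (Q ∘ₗ (L (Q (mon k x)) + L (mon k x) ∘ₗ Q) + lam • L (mon k x))) (fun y _ => ?_) hb
  have h : mrbElt lam x y ∈ (mrbIdeal X lam).toSubmodule := OperatedIdeal.subset_gen ⟨x, y, rfl⟩
  -- At words, left side minus right side of the identity is the negative of the generator.
  refine Eq.mp (congrArg (· ∈ (mrbIdeal X lam).toSubmodule) ?_) (neg_mem h)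
  simp only [L, Q, LinearMap.sub_apply, LinearMap.add_apply, LinearMap.smul_apply,
    LinearMap.comp_apply, LinearMap.mulLeft_apply, map_add, bracketOp_mon, mon_mul_mon, mrbElt,
    leadWord]
  abel

theorem exists_unique_hom (lam : k) {A : Type*} [NonUnitalRing A] [Module k A]
    [IsScalarTower k A A] [SMulCommClass k A A] (P : A →ₗ[k] A)
    (hP : IsModifiedRotaBaxter lam P) (φ : X → A) :
    ∃! F : FreeMRB X lam →ₙₐ[k] A,
      (∀ a, F ((mrbIdeal X lam).op a) = P (F a)) ∧
      ∀ x, F ((mrbIdeal X lam).proj (mon k (BWord.var x))) = φ x := by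
  refine ⟨(mrbIdeal X lam).liftHom (evalHom P φ) fun a ha =>
    evalHom_eq_zero P φ (fun x y => evalHom_mrbElt P φ lam x y (hP _ _)) ha, ⟨?_, ?_⟩, ?_⟩
  · intro a
    obtain ⟨a, rfl⟩ := (mrbIdeal X lam).proj_surjective a
    rw [OperatedIdeal.op_proj, OperatedIdeal.liftHom_proj, OperatedIdeal.liftHom_proj,
      evalHom_bracketOp]
  · intro x
    rw [OperatedIdeal.liftHom_proj, evalHom_mon, evalWord]
  · rintro F ⟨hF, hx⟩
    have hw (w : BWord X) : F ((mrbIdeal X lam).proj (mon k w)) = evalWord P φ w := by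
      have hbr (u : BWord X) : F ((mrbIdeal X lam).proj (mon k (.br u))) =
          P (F ((mrbIdeal X lam).proj (mon k u))) := by
        rw [← bracketOp_mon, ← OperatedIdeal.op_proj, hF]
      induction w with
      | var x => exact hx x
      | br u ih => rw [hbr, ih, evalWord]
      | varMul x v ih =>
        rw [← BWord.var_mul, ← mon_mul_mon, OperatedIdeal.proj_mul, map_mul, ih, hx]; rfl
      | brMul u v ihu ihv =>
        rw [← BWord.br_mul, ← mon_mul_mon, OperatedIdeal.proj_mul, map_mul, hbr, ihu, ihv]; rfl
    ext a
    obtain ⟨a, rfl⟩ := (mrbIdeal X lam).proj_surjective a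
    rw [OperatedIdeal.liftHom_proj]
    have : (F : FreeMRB X lam →ₗ[k] A) ∘ₗ (mrbIdeal X lam).proj =
        (evalHom P φ : WordAlg k X →ₗ[k] A) := linearMap_ext_mon fun w => by
      change F ((mrbIdeal X lam).proj (mon k w)) = evalHom P φ (mon k w)
      rw [hw, evalHom_mon]
    exact LinearMap.congr_fun this a

/-! ### Normal forms -/

/-- The normal form of a word. -/
def nf (lam : k) : BWord X → WordAlg k X :=
  evalWord (nfOpLin X lam) fun x => mon k (.var x)

/-- The linear extension of the normal form. -/
def nfHom (X : Type*) (lam : k) : WordAlg k X →ₙₐ[k] WordAlg k X :=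
  evalHom (nfOpLin X lam) fun x => mon k (.var x)

theorem nfHom_mon (lam : k) (w : BWord X) : nfHom X lam (mon k w) = nf lam w := evalHom_mon _ _ w

theorem nf_mem (lam : k) (w : BWord X) : nf lam w ∈ irrSpan k X := by
  induction w with
  | var x => exact mon_mem_irrSpan trivial
  | br u ih => exact nfOpLin_mem lam ih
  | varMul x v ih => exact mul_mem_irrSpan (mon_mem_irrSpan trivial) ih
  | brMul u v ihu ihv => exact mul_mem_irrSpan (nfOpLin_mem lam ihu) ihv

theorem nf_of_isIrr (lam : k) (w : BWord X) (hw : w.IsIrr) : nf lam w = mon k w := by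
  have hbr {u : BWord X} (hu : u.NotBrMul) (h : nf lam u = mon k u) :
      nfOpLin X lam (nf lam u) = mon k (.br u) := by
    rw [h, nfOpLin_mon, nfOp_of_notBrMul lam hu]
  induction w with
  | var x => rfl
  | br u ih => exact hbr hw.2 (ih hw.1)
  | varMul x v ih =>
    change mon k (.var x) * nf lam v = _
    rw [ih hw, mon_mul_mon, BWord.var_mul]
  | brMul u v ihu ihv =>
    change nfOpLin X lam (nf lam u) * nf lam v = _
    rw [hbr hw.1.2 (ihu hw.1.1), ihv hw.2, mon_mul_mon, BWord.br_mul]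

/-- All word values lie in `irrSpan` by `nf_mem`, and there `nfOpLin_mul` makes the generators
vanish. -/
theorem nfHom_eq_zero (lam : k) {a : WordAlg k X} (ha : a ∈ (mrbIdeal X lam).toSubmodule) :
    nfHom X lam a = 0 :=
  evalHom_eq_zero _ _ (fun x y => evalHom_mrbElt _ _ lam x y
    (nfOpLin_mul lam (nf_mem lam x) (nf_mem lam y))) ha

/-- The recursion for `nfOp` is the modified Rota–Baxter identity solved for ⌊⌊u⌋v⌋, which holds in
the quotient; so `nfOp` only rewrites ⌊w⌋ modulo the ideal. -/
theorem proj_nfOp (lam : k) (w : BWord X) (hw : w.IsIrr) :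
    (mrbIdeal X lam).proj (nfOp lam w) = (mrbIdeal X lam).op ((mrbIdeal X lam).proj (mon k w)) := by
  revert w hw
  refine irr_induction (fun u hu hu' => ?_) (fun u v hu hu' hv ihv ih => ?_)
  · rw [nfOp_of_notBrMul lam hu', OperatedIdeal.op_proj, bracketOp_mon]
  · have h : (mrbIdeal X lam).proj (nfOpLin X lam (mon k u * nfOp lam v)) =
        (mrbIdeal X lam).op ((mrbIdeal X lam).proj (mon k u * nfOp lam v)) := by
      let L := LinearMap.mulLeft k (mon k u)
      refine eqOn_wordSpan (f := (mrbIdeal X lam).proj ∘ₗ nfOpLin X lam ∘ₗ L)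
        (g := (mrbIdeal X lam).op ∘ₗ (mrbIdeal X lam).proj ∘ₗ L) (fun w hw => ?_)
        (nfOp_mem lam v hv)
      simp only [L, LinearMap.comp_apply, LinearMap.mulLeft_apply, mon_mul_mon, nfOpLin_mon]
      exact ih w hw
    rw [nfOp_brMul lam u hv, map_sub, map_sub, map_smul, OperatedIdeal.proj_mul, h,
      OperatedIdeal.proj_mul, ihv, ← bracketOp_mon, ← OperatedIdeal.op_proj, ← mon_mul_mon,
      OperatedIdeal.proj_mul, isModifiedRotaBaxter_op lam, ← BWord.br_mul, ← mon_mul_mon,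
      ← bracketOp_mon, OperatedIdeal.proj_mul, ← OperatedIdeal.op_proj, map_add]
    abel

theorem proj_nf (lam : k) (w : BWord X) :
    (mrbIdeal X lam).proj (nf lam w) = (mrbIdeal X lam).proj (mon k w) := by
  have hbr {u : BWord X} (ih : (mrbIdeal X lam).proj (nf lam u) = (mrbIdeal X lam).proj (mon k u)) :
      (mrbIdeal X lam).proj (nfOpLin X lam (nf lam u)) =
        (mrbIdeal X lam).proj (mon k (.br u)) := by
    rw [← bracketOp_mon, ← OperatedIdeal.op_proj, ← ih]
    refine eqOn_wordSpan (f := (mrbIdeal X lam).proj ∘ₗ nfOpLin X lam)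
      (g := (mrbIdeal X lam).op ∘ₗ (mrbIdeal X lam).proj) (fun w hw => ?_) (nf_mem lam u)
    rw [LinearMap.comp_apply, LinearMap.comp_apply, nfOpLin_mon, proj_nfOp lam w hw]
  induction w with
  | var x => rfl
  | br u ih => exact hbr ih
  | varMul x v ih =>
    change (mrbIdeal X lam).proj (mon k (.var x) * nf lam v) = _
    rw [OperatedIdeal.proj_mul, ih, ← OperatedIdeal.proj_mul, mon_mul_mon, BWord.var_mul]
  | brMul u v ihu ihv =>
    change (mrbIdeal X lam).proj (nfOpLin X lam (nf lam u) * nf lam v) = _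
    rw [OperatedIdeal.proj_mul, hbr ihu, ihv, ← OperatedIdeal.proj_mul, mon_mul_mon, BWord.br_mul]

theorem linearIndependent_irrWords (lam : k) : LinearIndependent k
    fun w : irrWords X => (mrbIdeal X lam).proj (mon k (w : BWord X)) := by
  let F : FreeMRB X lam →ₙₐ[k] WordAlg k X :=
    (mrbIdeal X lam).liftHom (nfHom X lam) fun _ => nfHom_eq_zero lam
  refine LinearIndependent.of_comp (F : FreeMRB X lam →ₗ[k] WordAlg k X) ?_
  convert (MonoidAlgebra.basis (BWord X) k).linearIndependent.comp
    (fun w : irrWords X => (w : BWord X)) Subtype.val_injective using 1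
  ext1 w
  change nfHom X lam (mon k (w : BWord X)) = _
  rw [nfHom_mon, nf_of_isIrr lam (w : BWord X) (mem_irrWords.1 w.2)]
  simp [mon]

theorem span_irrWords (lam : k) : ⊤ ≤ Submodule.span k
    (Set.range fun w : irrWords X => (mrbIdeal X lam).proj (mon k (w : BWord X))) := by
  rintro a -
  obtain ⟨a, rfl⟩ := (mrbIdeal X lam).proj_surjective a
  have ha : a ∈ wordSpan k Set.univ := wordSpan_univ (k := k) (X := X) ▸ Submodule.mem_top
  refine map_mem_of_mem_wordSpan (fun w _ => ?_) ha
  rw [← proj_nf]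
  refine map_mem_of_mem_wordSpan (fun v hv => ?_) (nf_mem lam w)
  exact Submodule.subset_span ⟨⟨v, mem_irrWords.2 hv⟩, rfl⟩

end

end MRB

open MRB in
theorem theorem4p6 {k : Type*} [CommRing k] [CharZero k] {X : Type*} [LinearOrder X]
    [WellFoundedLT X] (lam : k) :
    -- the strict path order is well-founded
    WellFounded (BWord.pathLT (X := X)) ∧
    -- leading monomials, also inside every context
    (∀ x y : BWord X, IsLeadingMonomial BWord.pathLT (mrbElt lam x y) (leadWord x y)) ∧
    (∀ (q : StarWord X) (x y : BWord X),
      IsLeadingMonomial BWord.pathLT (q.appLin (mrbElt lam x y)) (q.app (leadWord x y))) ∧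
    -- the Gröbner–Shirshov basis
    IsGroebnerShirshov BWord.pathLT (mrbSet X lam) ∧
    -- the quotient is the free nonunitary modified Rota–Baxter algebra of weight `lam` on `X`
    IsModifiedRotaBaxter lam (mrbIdeal X lam).op ∧
    (∀ (A : Type*) [NonUnitalRing A] [Module k A] [IsScalarTower k A A] [SMulCommClass k A A]
      (P : A →ₗ[k] A), IsModifiedRotaBaxter lam P → ∀ φ : X → A,
      ∃! F : FreeMRB X lam →ₙₐ[k] A,
        (∀ a, F ((mrbIdeal X lam).op a) = P (F a)) ∧
        ∀ x, F ((mrbIdeal X lam).proj (mon k (BWord.var x))) = φ x) ∧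
    -- the irreducible words form a basis of it
    ∃ b : Module.Basis (irrWords X) k (FreeMRB X lam),
      ∀ w : irrWords X, b w = (mrbIdeal X lam).proj (mon k (w : BWord X)) := by
  exact ⟨BWord.pathLT_wellFounded, isLeadingMonomial_mrbElt lam, isLeadingMonomial_appLin lam,
    isGroebnerShirshov_mrbSet lam, isModifiedRotaBaxter_op lam,
    fun A _ _ _ _ P hP φ => exists_unique_hom lam P hP φ,
    .mk (linearIndependent_irrWords lam) (span_irrWords lam), fun w => Module.Basis.mk_apply _ _ w⟩
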